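/- Let $n \in \mathbb{N}$ and let $0 < t < s < \frac{n}{2}$. Let $\eta \in C_c^\infty(\mathbb{R}^n)$ satisfy $0 \le \eta(x) \le 1$ for all $x \in \mathbb{R}^n$, $\eta(x) = 1$ for $|x| < 1$ and $\eta(x) = 0$ for $|x| \ge 2$. Let $\alpha \in \left(0, \frac{n}{2}\right)$ and let $\mathbf{f}_\alpha \in \mathcal{S}'(\mathbb{R}^n)$ be the regular distribution generated by $f_\alpha(x) = |x|^{-\alpha}$ for $x \ne 0$, $f_\alpha(0) = 0$. For $r \in \mathbb{R}$ let $H^r_2(\mathbb{R}^n)$ be the Bessel potential space of all $u \in \mathcal{S}'(\mathbb{R}^n)$ such that $J_r u := \mathcal{F}^{-1}\big((1+|\xi|^2)^{r/2}\,\mathcal{F}u\big)$ is given by a function in $L_2(\mathbb{R}^n)$, with the norm $\|u\|_{H^r_2} = \|J_r u\|_{L_2}$. A distribution $\mu$ is called a multiplier from $H^s_2(\mathbb{R}^n)$ to $H^t_2(\mathbb{R}^n)$, written $\mu \in M[H^s_2(\mathbb{R}^n) \to H^t_2(\mathbb{R}^n)]$, if $f \cdot \mu \in H^t_2(\mathbb{R}^n)$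 for every $f \in C_c^\infty(\mathbb{R}^n)$ and there is a constant $C \ge 0$ such that $\|f \cdot \mu\|_{H^t_2} \le C\, \|f\|_{H^s_2}$ for every (complex-valued) $f \in C_c^\infty(\mathbb{R}^n)$. If $\eta \cdot \mathbf{f}_\alpha \in M[H^s_2(\mathbb{R}^n) \to H^t_2(\mathbb{R}^n)]$, then $\alpha \le s - t$. -/

import Mathlib

open MeasureTheory TemperedDistribution
open scoped SchwartzMap ENNReal NNReal ContDiff

noncomputable section

namespace BesselMultiplier

section Regular

variable {E : Type*} [NormedAddCommGroup E] [InnerProductSpace ℝ E] [FiniteDimensional ℝ E]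
  [MeasurableSpace E] [BorelSpace E]

/-- A locally integrable function with at most polynomial growth outside some ball. -/
structure IsTemperedFun (f : E → ℂ) : Prop where
  locallyIntegrable : LocallyIntegrable f volume
  growth : ∃ r : ℝ, 0 < r ∧ ∃ (N : ℕ) (C : ℝ), 0 ≤ C ∧
    ∀ x, r ≤ ‖x‖ → ‖f x‖ ≤ C * (1 + ‖x‖ ^ 2) ^ N

theorem IsTemperedFun.exists_integrable {f : E → ℂ} (hf : IsTemperedFun f) :
    ∃ k : ℕ, Integrable (fun x ↦ ((1 + ‖x‖) ^ k)⁻¹ * ‖f x‖) (volume : Measure E) := by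
  obtain ⟨r, -, N, C, hC, h⟩ := hf.growth
  set d := (volume : Measure E).integrablePower
  refine ⟨2 * N + d, ?_⟩
  have hmeas : AEStronglyMeasurable (fun x ↦ ((1 + ‖x‖) ^ (2 * N + d))⁻¹ * ‖f x‖)
      (volume : Measure E) := by
    refine AEStronglyMeasurable.mul (Continuous.aestronglyMeasurable ?_)
      hf.locallyIntegrable.aestronglyMeasurable.norm
    exact Continuous.inv₀ (by fun_prop) (fun x ↦ by positivity)
  have h1 : Integrable (Set.indicator (Metric.closedBall (0 : E) r) fun x ↦ ‖f x‖) volume :=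
    (integrable_indicator_iff measurableSet_closedBall).2
      (hf.locallyIntegrable.integrableOn_isCompact (isCompact_closedBall 0 r)).norm
  have h2 := (Measure.integrable_pow_neg_integrablePower (volume : Measure E)).const_mul C
  refine (h1.add h2).mono' hmeas (Filter.Eventually.of_forall fun x ↦ ?_)
  have hx1 : (1 : ℝ) ≤ 1 + ‖x‖ := by linarith [norm_nonneg x]
  rw [Real.norm_of_nonneg (by positivity)]
  simp only [Pi.add_apply]
  have hp : (0 : ℝ) ≤ (1 + ‖x‖) ^ (-(d : ℝ)) := by positivity
  by_cases hx : x ∈ Metric.closedBall (0 : E) r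
  · rw [Set.indicator_of_mem hx]
    have : ((1 + ‖x‖) ^ (2 * N + d))⁻¹ ≤ 1 := inv_le_one_of_one_le₀ (one_le_pow₀ hx1)
    have := mul_le_mul_of_nonneg_right this (norm_nonneg (f x))
    have := mul_nonneg hC hp
    linarith
  · rw [Set.indicator_of_notMem hx, zero_add]
    have hr : r ≤ ‖x‖ := by
      rw [mem_closedBall_zero_iff, not_le] at hx
      exact hx.le
    have hle : (1 + ‖x‖ ^ 2) ^ N ≤ (1 + ‖x‖) ^ (2 * N) := by
      rw [pow_mul]
      exact pow_le_pow_left₀ (by positivity) (by nlinarith [norm_nonneg x]) N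
    rw [Real.rpow_neg (by positivity), Real.rpow_natCast, pow_add, mul_inv]
    calc ((1 + ‖x‖) ^ (2 * N))⁻¹ * ((1 + ‖x‖) ^ d)⁻¹ * ‖f x‖
        ≤ ((1 + ‖x‖) ^ (2 * N))⁻¹ * ((1 + ‖x‖) ^ d)⁻¹ * (C * (1 + ‖x‖) ^ (2 * N)) := by
          gcongr
          exact (h x hr).trans (mul_le_mul_of_nonneg_left hle hC)
      _ = C * ((1 + ‖x‖) ^ d)⁻¹ := by
          have : (1 + ‖x‖) ^ (2 * N) ≠ 0 := by positivity
          field_simp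

theorem norm_mul_le_seminorm (k : ℕ) (f : E → ℂ) (φ : 𝓢(E, ℂ)) (x : E) :
    ‖φ x * f x‖ ≤ (2 ^ k * ((Finset.Iic (k, 0)).sup (schwartzSeminormFamily ℂ E ℂ)) φ) *
      (((1 + ‖x‖) ^ k)⁻¹ * ‖f x‖) := by
  have h := SchwartzMap.one_add_le_sup_seminorm_apply (𝕜 := ℂ) (m := (k, 0)) (k := k) (n := 0)
    le_rfl le_rfl φ x
  rw [norm_iteratedFDeriv_zero] at h
  have hp : (0 : ℝ) < (1 + ‖x‖) ^ k := by positivity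
  rw [norm_mul, ← mul_assoc]
  gcongr
  rw [← div_eq_mul_inv, le_div_iff₀ hp, mul_comm]
  exact h

theorem IsTemperedFun.integrable_mul {f : E → ℂ} (hf : IsTemperedFun f) (φ : 𝓢(E, ℂ)) :
    Integrable (fun x ↦ φ x * f x) (volume : Measure E) := by
  obtain ⟨k, hk⟩ := hf.exists_integrable
  refine (hk.const_mul _).mono' ?_
    (Filter.Eventually.of_forall fun x ↦ norm_mul_le_seminorm k f φ x)
  exact φ.continuous.aestronglyMeasurable.mul hf.locallyIntegrable.aestronglyMeasurable

/-- The regular tempered distribution `φ ↦ ∫ φ(x) f(x) dx` generated by `f`. -/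
def regularDistribution (f : E → ℂ) (hf : IsTemperedFun f) : 𝓢'(E, ℂ) :=
  ContinuousLinearMap.toPointwiseConvergenceCLM _ _ _ _
    (SchwartzMap.mkCLMtoNormedSpace (𝕜 := ℂ) (σ := RingHom.id ℂ)
      (fun φ : 𝓢(E, ℂ) ↦ ∫ x, φ x * f x)
      (fun φ ψ ↦ by
        simp only [add_apply, add_mul]
        exact integral_add (hf.integrable_mul φ) (hf.integrable_mul ψ))
      (fun c φ ↦ by
        simp only [smul_apply, smul_eq_mul, mul_assoc, RingHom.id_apply]
        exact integral_const_mul c _)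
      (by
        obtain ⟨k, hk⟩ := hf.exists_integrable
        refine ⟨Finset.Iic (k, 0), 2 ^ k * ∫ x, ((1 + ‖x‖) ^ k)⁻¹ * ‖f x‖, ?_, fun φ ↦ ?_⟩
        · exact mul_nonneg (by positivity) (integral_nonneg fun x ↦ by positivity)
        · refine (norm_integral_le_of_norm_le (hk.const_mul _) (Filter.Eventually.of_forall
            fun x ↦ norm_mul_le_seminorm k f φ x)).trans (le_of_eq ?_)
          rw [integral_const_mul]
          ring))

@[simp]
theorem regularDistribution_apply (f : E → ℂ) (hf : IsTemperedFun f) (φ : 𝓢(E, ℂ)) :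
    regularDistribution f hf φ = ∫ x, φ x * f x := rfl

end Regular

section Sobolev

variable {E : Type*} [NormedAddCommGroup E] [InnerProductSpace ℝ E] [FiniteDimensional ℝ E]
  [MeasurableSpace E] [BorelSpace E]

/-- The norm `‖J_s u‖_{L_p}` of a tempered distribution `u` in the Bessel potential space `H^s_p`;
it is `∞` when `u` is not in `H^s_p`. The representative `g` is unique when it exists, see
`sobolevENorm_eq`. `TemperedDistribution.besselPotential` is the Fourier multiplier
`(1 + ‖ξ‖²)^{s/2}` for the Fourier transform with kernel `e^{-2πi⟨x,ξ⟩}`. -/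
def sobolevENorm (s : ℝ) (p : ℝ≥0∞) [Fact (1 ≤ p)] (u : 𝓢'(E, ℂ)) : ℝ≥0∞ :=
  ⨅ (g : Lp ℂ p (volume : Measure E)) (_ : besselPotential E ℂ s u = (g : 𝓢'(E, ℂ))), ‖g‖ₑ

theorem sobolevENorm_eq {s : ℝ} {p : ℝ≥0∞} [Fact (1 ≤ p)] {u : 𝓢'(E, ℂ)}
    {g : Lp ℂ p (volume : Measure E)} (h : besselPotential E ℂ s u = (g : 𝓢'(E, ℂ))) :
    sobolevENorm s p u = ‖g‖ₑ := by
  refine le_antisymm (iInf₂_le g h) (le_iInf₂ fun g' h' ↦ le_of_eq ?_)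
  have hinj := LinearMap.ker_eq_bot.1
    (Lp.ker_toTemperedDistributionCLM_eq_bot (F := ℂ) (μ := (volume : Measure E)) (p := p))
  have : g = g' := hinj (h.symm.trans h')
  rw [this]

theorem sobolevENorm_lt_top_iff {s : ℝ} {p : ℝ≥0∞} [Fact (1 ≤ p)] {u : 𝓢'(E, ℂ)} :
    sobolevENorm s p u < ⊤ ↔ MemSobolev s p u := by
  simp [sobolevENorm, iInf_lt_iff, MemSobolev, enorm_lt_top]

/-- `u` lies locally in `H^s_p`: `f · u ∈ H^s_p` for every test function `f`. -/
def MemSobolevLoc (s : ℝ) (p : ℝ≥0∞) [Fact (1 ≤ p)] (u : 𝓢'(E, ℂ)) : Prop :=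
  ∀ f : E → ℂ, ContDiff ℝ ∞ f → HasCompactSupport f → MemSobolev s p (smulLeftCLM ℂ f u)

/-- `u` is a multiplier from `H^s_p` to `H^t_q`: it lies locally in `H^t_q`, and there is a
constant `C` with `‖f · u‖_{H^t_q} ≤ C ‖f‖_{H^s_p}` for every test function `f`. -/
def IsMultiplier (s : ℝ) (p : ℝ≥0∞) (t : ℝ) (q : ℝ≥0∞) [Fact (1 ≤ p)] [Fact (1 ≤ q)]
    (u : 𝓢'(E, ℂ)) : Prop :=
  MemSobolevLoc t q u ∧
    ∃ C : ℝ≥0, ∀ (f : E → ℂ) (hf : ContDiff ℝ ∞ f) (hc : HasCompactSupport f),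
      sobolevENorm t q (smulLeftCLM ℂ f u) ≤
        C * sobolevENorm s p ((hc.toSchwartzMap hf : 𝓢(E, ℂ)) : 𝓢'(E, ℂ))

end Sobolev

/-- The function `|x|^{-α}` on `ℝⁿ`, with value `0` at the origin. -/
def powFun (n : ℕ) (α : ℝ) (x : EuclideanSpace ℝ (Fin n)) : ℂ :=
  if x = 0 then 0 else ((1 / ‖x‖ ^ α : ℝ) : ℂ)

theorem isTemperedFun_powFun {n : ℕ} {α : ℝ} (h0 : 0 < α) (hn : α < n) :
    IsTemperedFun (powFun n α) := by
  have hle : ∀ x, ‖powFun n α x‖ ≤ 1 * ‖x‖ ^ (-α) := by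
    intro x
    unfold powFun
    split_ifs with h
    · simp only [norm_zero]; positivity
    · rw [Complex.norm_real, Real.norm_of_nonneg (by positivity),
        Real.rpow_neg (norm_nonneg x), one_div, one_mul]
  constructor
  · refine locallyIntegrable_of_norm_le_rpow (C := 1) (α := α) ?_ ?_
      (Filter.Eventually.of_forall hle) ?_
    · rw [finrank_euclideanSpace_fin]
      have : (0 : ℝ) < n := h0.trans hn
      exact_mod_cast this
    · simpa using hn
    · refine Measurable.aestronglyMeasurable ?_
      unfold powFun
      exact Measurable.ite (measurableSet_singleton 0) (by fun_prop) (by fun_prop)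
  · refine ⟨1, one_pos, 0, 1, zero_le_one, fun x hx ↦ (hle x).trans ?_⟩
    simpa using Real.rpow_le_one_of_one_le_of_nonpos hx (by linarith)

/-- The regular tempered distribution on `ℝⁿ` generated by `|x|^{-α}`, for `0 < α < n`. -/
def powDistribution (n : ℕ) (α : ℝ) (h0 : 0 < α) (hn : α < n) :
    𝓢'(EuclideanSpace ℝ (Fin n), ℂ) :=
  regularDistribution (powFun n α) (isTemperedFun_powFun h0 hn)

end BesselMultiplier

end

/-!
The proof tests the multiplier `u = η · |x|^{-α}` on the functions `f_ε = φ(·/ε)`, which concentrate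
at the origin as `ε → 0`. Rescaling the Bessel symbol on the Fourier side gives
`‖f_ε‖_{H^r_2} ≤ K ε^{d/2 - r}` for every `r > -d/2`; the condition on `r` makes `|ξ|^{2r}`, the
limit of the rescaled weights, locally integrable. Since `H^{-t}_2` is dual to `H^t_2`, the
multiplier bound yields
`|⟨f_ε · u, f_ε⟩| ≤ C ‖f_ε‖_{H^s_2} ‖f_ε‖_{H^{-t}_2} ≤ K' ε^{d - s + t}`.
As soon as `η = 1` on the support of `f_ε`, homogeneity makes the left-hand side a constant multiple
of `ε^{d - α}`, nonzero for suitable `φ`. Letting `ε → 0` forces `d - s + t ≤ d - α`.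
-/

noncomputable section

namespace BesselMultiplier

open FourierTransform Filter Topology Module

section BesselSymbol

/-- The symbol `(1 + ‖ξ‖²)^{r/2}` of the Bessel potential of order `r`, as a complex-valued
function. -/
def besselSymbol {E : Type*} [NormedAddCommGroup E] (r : ℝ) (ξ : E) : ℂ :=
  ((1 + ‖ξ‖ ^ 2) ^ (r / 2) : ℝ)

theorem norm_besselSymbol {E : Type*} [NormedAddCommGroup E] (r : ℝ) (ξ : E) :
    ‖besselSymbol r ξ‖ = (1 + ‖ξ‖ ^ 2) ^ (r / 2) := by
  rw [besselSymbol, Complex.norm_real, Real.norm_of_nonneg (by positivity)]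

theorem hasTemperateGrowth_besselSymbol {E : Type*} [NormedAddCommGroup E]
    [InnerProductSpace ℝ E] (r : ℝ) : (besselSymbol r : E → ℂ).HasTemperateGrowth := by
  unfold besselSymbol
  fun_prop

theorem norm_besselSymbol_inv_smul_le {E : Type*} [NormedAddCommGroup E] [NormedSpace ℝ E]
    (r : ℝ) {ε : ℝ} (hε : 0 < ε) (hε1 : ε ≤ 1) {ξ : E} (hξ : ξ ≠ 0) :
    ‖besselSymbol r (ε⁻¹ • ξ)‖ ≤ ε ^ (-r) * (‖besselSymbol r ξ‖ + ‖ξ‖ ^ r) := by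
  have hscale : ‖besselSymbol r (ε⁻¹ • ξ)‖ = ε ^ (-r) * (ε ^ 2 + ‖ξ‖ ^ 2) ^ (r / 2) := by
    have hweight : 1 + ‖ε⁻¹ • ξ‖ ^ 2 = (ε ^ (-1 : ℝ)) ^ 2 * (ε ^ 2 + ‖ξ‖ ^ 2) := by
      rw [norm_smul, Real.norm_of_nonneg (by positivity), Real.rpow_neg_one]
      field_simp
    rw [norm_besselSymbol, hweight, Real.mul_rpow (by positivity) (by positivity),
      ← Real.rpow_natCast_mul (by positivity), ← Real.rpow_mul hε.le]
    congr 2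
    push_cast
    ring
  have hnorm : (‖ξ‖ ^ 2) ^ (r / 2) = ‖ξ‖ ^ r := by
    rw [← Real.rpow_natCast_mul (norm_nonneg ξ)]
    congr 1
    push_cast
    ring
  rw [hscale, norm_besselSymbol, ← hnorm]
  gcongr
  -- `(ε² + ‖ξ‖²)^{r/2}` is monotone in `ε`: compare with `ε = 1` if `0 ≤ r`,
  -- with `ε = 0` if `r ≤ 0`.
  rcases le_total 0 r with hr | hr
  · exact (Real.rpow_le_rpow (by positivity) (by gcongr; exact pow_le_one₀ hε.le hε1)
      (by linarith)).trans (le_add_of_nonneg_right (by positivity))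
  · exact (Real.rpow_le_rpow_of_nonpos (by positivity)
      (le_add_of_nonneg_left (by positivity)) (by linarith)).trans
      (le_add_of_nonneg_left (by positivity))

end BesselSymbol

section Duality

variable {E : Type*} [NormedAddCommGroup E] [InnerProductSpace ℝ E] [FiniteDimensional ℝ E]
  [MeasurableSpace E] [BorelSpace E]

theorem sobolevENorm_coe (r : ℝ) (p : ℝ≥0∞) [Fact (1 ≤ p)] (ψ : 𝓢(E, ℂ)) :
    sobolevENorm r p (ψ : 𝓢'(E, ℂ)) =
      eLpNorm (SchwartzMap.fourierMultiplierCLM ℂ (besselSymbol r) ψ) p volume := by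
  have h : besselPotential E ℂ r (ψ : 𝓢'(E, ℂ)) =
      ((SchwartzMap.fourierMultiplierCLM ℂ (besselSymbol r) ψ).toLp p : 𝓢'(E, ℂ)) := by
    rw [Lp.toTemperedDistribution_toLp_eq]
    exact fourierMultiplierCLM_toTemperedDistributionCLM_eq (hasTemperateGrowth_besselSymbol r) ψ
  rw [sobolevENorm_eq h, Lp.enorm_def, eLpNorm_congr_ae (SchwartzMap.coeFn_toLp _ p volume)]

theorem sobolevENorm_two_coe (r : ℝ) (ψ : 𝓢(E, ℂ)) :
    sobolevENorm r 2 (ψ : 𝓢'(E, ℂ)) = eLpNorm (fun ξ ↦ besselSymbol r ξ * 𝓕 ψ ξ) 2 volume := by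
  have plancherel (φ : 𝓢(E, ℂ)) : eLpNorm (𝓕 φ : 𝓢(E, ℂ)) 2 volume = eLpNorm φ 2 volume := by
    rw [← eLpNorm_congr_ae (SchwartzMap.coeFn_toLp (𝓕 φ) 2 volume), ← Lp.enorm_def,
      ← ofReal_norm, SchwartzMap.norm_fourier_toL2_eq, ofReal_norm, Lp.enorm_def,
      eLpNorm_congr_ae (SchwartzMap.coeFn_toLp φ 2 volume)]
  rw [sobolevENorm_coe, ← plancherel, SchwartzMap.fourierMultiplierCLM_apply,
    FourierTransform.fourier_fourierInv_eq]
  exact congrArg (eLpNorm · 2 volume) (funext fun ξ ↦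
    SchwartzMap.smulLeftCLM_apply_apply (hasTemperateGrowth_besselSymbol r) _ ξ)

theorem fourierMultiplierCLM_apply_of_even {F : Type*} [NormedAddCommGroup F] [NormedSpace ℂ F]
    {g : E → ℂ} (hg : g.HasTemperateGrowth) (heven : g.Even) (u : 𝓢'(E, F)) (ψ : 𝓢(E, ℂ)) :
    fourierMultiplierCLM F g u ψ = u (SchwartzMap.fourierMultiplierCLM ℂ g ψ) := by
  rw [fourierMultiplierCLM_apply_apply, SchwartzMap.fourierMultiplierCLM_apply]
  refine congrArg u (SchwartzMap.ext fun x ↦ ?_)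
  rw [SchwartzMap.fourier_coe, SchwartzMap.fourierInv_coe, Real.fourierInv_eq_fourier_comp_neg]
  refine congrArg (fun h : E → ℂ ↦ 𝓕 h x) (funext fun ξ ↦ ?_)
  rw [SchwartzMap.smulLeftCLM_apply_apply hg, SchwartzMap.smulLeftCLM_apply_apply hg, heven,
    SchwartzMap.fourier_coe, SchwartzMap.fourierInv_coe, Real.fourierInv_eq_fourier_neg]

theorem enorm_toTemperedDistribution_apply_le {p q : ℝ≥0∞} [Fact (1 ≤ p)] [p.HolderConjugate q]
    (g : Lp ℂ p (volume : Measure E)) (ψ : 𝓢(E, ℂ)) :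
    ‖(g : 𝓢'(E, ℂ)) ψ‖ₑ ≤ ‖g‖ₑ * eLpNorm ψ q volume := by
  rw [Lp.toTemperedDistribution_apply, Lp.enorm_def, mul_comm]
  refine (enorm_integral_le_lintegral_enorm _).trans ?_
  rw [← eLpNorm_one_eq_lintegral_enorm]
  exact eLpNorm_smul_le_mul_eLpNorm (p := q) (q := p) (r := 1) (f := g) (φ := ψ)
    (Lp.aestronglyMeasurable g) ψ.continuous.aestronglyMeasurable

theorem enorm_apply_le_sobolevENorm_mul {t : ℝ} {p q : ℝ≥0∞} [Fact (1 ≤ p)] [Fact (1 ≤ q)]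
    [p.HolderConjugate q] {u : 𝓢'(E, ℂ)} (hu : MemSobolev t p u) (ψ : 𝓢(E, ℂ)) :
    ‖u ψ‖ₑ ≤ sobolevENorm t p u * sobolevENorm (-t) q (ψ : 𝓢'(E, ℂ)) := by
  obtain ⟨g, hg⟩ := hu
  have huψ : u ψ = (g : 𝓢'(E, ℂ)) (SchwartzMap.fourierMultiplierCLM ℂ (besselSymbol (-t)) ψ) := by
    rw [← (besselPotential_neg_apply_eq_iff t _ u).2 hg]
    exact fourierMultiplierCLM_apply_of_even (hasTemperateGrowth_besselSymbol (-t))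
      (fun ξ ↦ by simp only [besselSymbol, norm_neg]) _ _
  rw [huψ, sobolevENorm_eq hg, sobolevENorm_coe]
  exact enorm_toTemperedDistribution_apply_le g _

theorem IsMultiplier.exists_enorm_smulLeftCLM_apply_le {s t : ℝ} {p q q' : ℝ≥0∞} [Fact (1 ≤ p)]
    [Fact (1 ≤ q)] [Fact (1 ≤ q')] [q.HolderConjugate q'] {u : 𝓢'(E, ℂ)}
    (hu : IsMultiplier s p t q u) :
    ∃ C : ℝ≥0, ∀ φ ψ : 𝓢(E, ℂ), HasCompactSupport φ →
      ‖smulLeftCLM ℂ φ u ψ‖ₑ ≤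
        C * sobolevENorm s p (φ : 𝓢'(E, ℂ)) * sobolevENorm (-t) q' (ψ : 𝓢'(E, ℂ)) := by
  obtain ⟨hloc, C, hC⟩ := hu
  refine ⟨C, fun φ ψ hφ ↦
    (enorm_apply_le_sobolevENorm_mul (q := q') (hloc φ φ.smooth' hφ) ψ).trans ?_⟩
  gcongr
  exact hC φ φ.smooth' hφ

end Duality

section Dilation

variable {E : Type*} [NormedAddCommGroup E] [NormedSpace ℝ E]

/-- The rescaled Schwartz function `x ↦ φ (ε⁻¹ x)`, which concentrates at the origin as
`ε → 0`. -/
def dilation {ε : ℝ} (hε : ε ≠ 0) (φ : 𝓢(E, ℂ)) : 𝓢(E, ℂ) :=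
  SchwartzMap.compCLMOfContinuousLinearEquiv ℂ
    (ContinuousLinearEquiv.smulLeft (Units.mk0 ε⁻¹ (inv_ne_zero hε)) : E ≃L[ℝ] E) φ

theorem dilation_apply {ε : ℝ} (hε : ε ≠ 0) (φ : 𝓢(E, ℂ)) (x : E) :
    dilation hε φ x = φ (ε⁻¹ • x) := rfl

theorem hasCompactSupport_dilation {ε : ℝ} (hε : ε ≠ 0) {φ : 𝓢(E, ℂ)}
    (hφ : HasCompactSupport φ) : HasCompactSupport (dilation hε φ) :=
  hφ.comp_homeomorph (Homeomorph.smulOfNeZero ε⁻¹ (inv_ne_zero hε))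

theorem eLpNorm_comp_smul {F : Type*} [NormedAddCommGroup F] [FiniteDimensional ℝ E]
    [MeasurableSpace E] [BorelSpace E] (μ : Measure E) [μ.IsAddHaarMeasure] {p : ℝ≥0∞} (hp : p ≠ ⊤)
    {c : ℝ} (hc : c ≠ 0) (f : E → F) :
    eLpNorm (fun x ↦ f (c • x)) p μ =
      ENNReal.ofReal |(c ^ finrank ℝ E)⁻¹| ^ (1 / p).toReal * eLpNorm f p μ := by
  have hmap := (measurableEmbedding_const_smul₀ hc).eLpNorm_map_measure (μ := μ) (g := f) (p := p)
  rw [Measure.map_addHaar_smul μ hc, eLpNorm_smul_measure_of_ne_top hp, smul_eq_mul] at hmap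
  exact hmap.symm

end Dilation

section DilationNorm

variable {E : Type*} [NormedAddCommGroup E] [InnerProductSpace ℝ E] [FiniteDimensional ℝ E]
  [MeasurableSpace E] [BorelSpace E]

theorem fourier_comp_inv_smul {F : Type*} [NormedAddCommGroup F] [NormedSpace ℂ F]
    (f : E → F) {ε : ℝ} (hε : 0 < ε) (ξ : E) :
    𝓕 (fun x ↦ f (ε⁻¹ • x)) ξ = ε ^ finrank ℝ E • 𝓕 f (ε • ξ) := by
  rw [Real.fourier_eq, Real.fourier_eq, ← abs_of_pos (pow_pos hε (finrank ℝ E)),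
    ← Measure.integral_comp_inv_smul]
  simp only [inner_smul_left, inner_smul_right, map_inv₀, conj_trivial]
  simp [hε.ne']

theorem sobolevENorm_two_dilation (r : ℝ) {ε : ℝ} (hε : 0 < ε) (φ : 𝓢(E, ℂ)) :
    sobolevENorm r 2 (dilation hε.ne' φ : 𝓢'(E, ℂ)) =
      ENNReal.ofReal (ε ^ (finrank ℝ E / 2 : ℝ)) *
        eLpNorm (fun ξ ↦ besselSymbol r (ε⁻¹ • ξ) * 𝓕 φ ξ) 2 volume := by
  set d := finrank ℝ E
  have hfourier : (fun ξ ↦ besselSymbol r ξ * 𝓕 (dilation hε.ne' φ) ξ) =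
      (ε ^ d : ℝ) • fun ξ ↦ besselSymbol r (ε⁻¹ • ε • ξ) * 𝓕 φ (ε • ξ) := by
    ext ξ
    have h : 𝓕 (dilation hε.ne' φ) ξ = ε ^ d • 𝓕 φ (ε • ξ) := by
      rw [SchwartzMap.fourier_coe, SchwartzMap.fourier_coe]
      exact fourier_comp_inv_smul φ hε ξ
    rw [Pi.smul_apply, h, inv_smul_smul₀ hε.ne', mul_smul_comm]
  have hconst : ‖ε ^ d‖ₑ * ENNReal.ofReal |(ε ^ d)⁻¹| ^ (1 / (2 : ℝ≥0∞)).toReal =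
      ENNReal.ofReal (ε ^ (d / 2 : ℝ)) := by
    rw [Real.enorm_of_nonneg (by positivity), abs_of_pos (by positivity),
      ENNReal.ofReal_rpow_of_pos (by positivity), ← ENNReal.ofReal_mul (by positivity),
      ← Real.rpow_natCast, ← Real.rpow_neg hε.le, ← Real.rpow_mul hε.le, ← Real.rpow_add hε]
    congr 2
    norm_num
    ring
  rw [sobolevENorm_two_coe, hfourier, eLpNorm_const_smul,
    eLpNorm_comp_smul volume ENNReal.ofNat_ne_top hε.ne'
      (fun ξ ↦ besselSymbol r (ε⁻¹ • ξ) * 𝓕 φ ξ), ← mul_assoc, hconst]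

end DilationNorm

section DilationEstimate

variable {E : Type*} [NormedAddCommGroup E] [InnerProductSpace ℝ E] [FiniteDimensional ℝ E]
  [MeasurableSpace E] [BorelSpace E]

theorem IsTemperedFun.integrable_sq_mul {f : E → ℂ} (hf : IsTemperedFun f) (ψ : 𝓢(E, ℂ)) :
    Integrable (fun x ↦ ψ x ^ 2 * f x) volume := by
  simpa only [SchwartzMap.smulLeftCLM_apply_apply ψ.hasTemperateGrowth, smul_eq_mul, ← sq] using
    hf.integrable_mul (SchwartzMap.smulLeftCLM ℂ ψ ψ)

theorem memLp_two_mul_of_isTemperedFun_sq {f : E → ℂ} (hf : AEStronglyMeasurable f volume)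
    (hf2 : IsTemperedFun (fun x ↦ f x ^ 2)) (ψ : 𝓢(E, ℂ)) :
    MemLp (fun x ↦ ψ x * f x) 2 volume := by
  refine (memLp_two_iff_integrable_sq_norm (ψ.continuous.aestronglyMeasurable.mul hf)).2 ?_
  simpa only [← norm_pow, Pi.mul_apply, mul_pow] using (hf2.integrable_sq_mul ψ).norm

variable [Nontrivial E]

theorem isTemperedFun_norm_rpow {r : ℝ} (hr : -finrank ℝ E < r) :
    IsTemperedFun (fun x : E ↦ ((‖x‖ ^ r : ℝ) : ℂ)) where
  locallyIntegrable := by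
    refine locallyIntegrable_of_norm_le_rpow (C := 1) (α := -r) finrank_pos (by linarith)
      (.of_forall fun x ↦ ?_) (Measurable.aestronglyMeasurable (by fun_prop))
    rw [Complex.norm_real, Real.norm_of_nonneg (by positivity), neg_neg, one_mul]
  growth := by
    refine ⟨1, one_pos, ⌈r⌉₊, 1, zero_le_one, fun x hx ↦ ?_⟩
    rw [Complex.norm_real, Real.norm_of_nonneg (by positivity), one_mul]
    calc ‖x‖ ^ r ≤ ‖x‖ ^ (⌈r⌉₊ : ℝ) := Real.rpow_le_rpow_of_exponent_le hx (Nat.le_ceil r)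
      _ = ‖x‖ ^ ⌈r⌉₊ := Real.rpow_natCast _ _
      _ ≤ (1 + ‖x‖ ^ 2) ^ ⌈r⌉₊ := by
        gcongr
        nlinarith

theorem memLp_two_mul_norm_rpow {r : ℝ} (hr : -(finrank ℝ E / 2 : ℝ) < r) (ψ : 𝓢(E, ℂ)) :
    MemLp (fun x ↦ ψ x * ((‖x‖ ^ r : ℝ) : ℂ)) 2 volume := by
  refine memLp_two_mul_of_isTemperedFun_sq
    (Measurable.aestronglyMeasurable (by fun_prop)) ?_ ψ
  convert isTemperedFun_norm_rpow (E := E) (r := r * 2) (by linarith) using 2 with x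
  rw [Real.rpow_mul (norm_nonneg x), Real.rpow_two, Complex.ofReal_pow]

theorem memLp_two_besselSymbol_add_norm_rpow_mul {r : ℝ} (hr : -(finrank ℝ E / 2 : ℝ) < r)
    (ψ : 𝓢(E, ℂ)) :
    MemLp (fun ξ ↦ (‖besselSymbol r ξ‖ + ‖ξ‖ ^ r) * ‖ψ ξ‖) 2 volume := by
  have hbessel : MemLp (fun ξ ↦ ψ ξ * besselSymbol r ξ) 2 volume := by
    convert (SchwartzMap.smulLeftCLM ℂ (besselSymbol r) ψ).memLp 2 volume using 2 with ξ
    rw [SchwartzMap.smulLeftCLM_apply_apply (hasTemperateGrowth_besselSymbol r), smul_eq_mul,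
      mul_comm]
  convert hbessel.norm.add (memLp_two_mul_norm_rpow hr ψ).norm using 2 with ξ
  rw [Pi.add_apply, norm_mul, norm_mul, Complex.norm_real, Real.norm_of_nonneg (by positivity)]
  ring

theorem exists_sobolevENorm_two_dilation_le {r : ℝ} (hr : -(finrank ℝ E / 2 : ℝ) < r)
    (φ : 𝓢(E, ℂ)) :
    ∃ K : ℝ≥0, ∀ (ε : ℝ) (hε : 0 < ε), ε ≤ 1 →
      sobolevENorm r 2 (dilation hε.ne' φ : 𝓢'(E, ℂ)) ≤
        K * ENNReal.ofReal (ε ^ (finrank ℝ E / 2 - r : ℝ)) := by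
  set majorant : E → ℝ := fun ξ ↦ (‖besselSymbol r ξ‖ + ‖ξ‖ ^ r) * ‖𝓕 φ ξ‖
  have hfinite : eLpNorm majorant 2 volume ≠ ⊤ :=
    (memLp_two_besselSymbol_add_norm_rpow_mul hr (𝓕 φ)).eLpNorm_ne_top
  refine ⟨(eLpNorm majorant 2 volume).toNNReal, fun ε hε hε1 ↦ ?_⟩
  have hle : ∀ᵐ ξ : E, ‖besselSymbol r (ε⁻¹ • ξ) * 𝓕 φ ξ‖ ≤ ε ^ (-r) * ‖majorant ξ‖ := by
    filter_upwards [volume.ae_ne (0 : E)] with ξ hξ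
    rw [norm_mul, Real.norm_of_nonneg (by positivity), ← mul_assoc]
    gcongr
    exact norm_besselSymbol_inv_smul_le r hε hε1 hξ
  calc sobolevENorm r 2 (dilation hε.ne' φ : 𝓢'(E, ℂ))
      = ENNReal.ofReal (ε ^ (finrank ℝ E / 2 : ℝ)) *
          eLpNorm (fun ξ ↦ besselSymbol r (ε⁻¹ • ξ) * 𝓕 φ ξ) 2 volume :=
        sobolevENorm_two_dilation r hε φ
    _ ≤ ENNReal.ofReal (ε ^ (finrank ℝ E / 2 : ℝ)) *
          (ENNReal.ofReal (ε ^ (-r)) * eLpNorm majorant 2 volume) := by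
        gcongr
        exact eLpNorm_le_mul_eLpNorm_of_ae_le_mul hle 2
    _ = (eLpNorm majorant 2 volume).toNNReal *
          ENNReal.ofReal (ε ^ (finrank ℝ E / 2 - r : ℝ)) := by
        rw [← mul_assoc, ← ENNReal.ofReal_mul (by positivity), ← Real.rpow_add hε,
          ← sub_eq_add_neg, ENNReal.coe_toNNReal hfinite, mul_comm]

theorem IsMultiplier.exists_norm_smulLeftCLM_dilation_apply_le {s t : ℝ}
    (hs : -(finrank ℝ E / 2 : ℝ) < s) (ht : t < finrank ℝ E / 2) {u : 𝓢'(E, ℂ)}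
    (hu : IsMultiplier s 2 t 2 u) {φ : 𝓢(E, ℂ)} (hφ : HasCompactSupport φ) :
    ∃ K : ℝ, ∀ (ε : ℝ) (hε : 0 < ε), ε ≤ 1 →
      ‖smulLeftCLM ℂ (dilation hε.ne' φ) u (dilation hε.ne' φ)‖ ≤
        K * ε ^ (finrank ℝ E - s + t : ℝ) := by
  obtain ⟨C, hC⟩ := hu.exists_enorm_smulLeftCLM_apply_le (q' := 2)
  obtain ⟨K, hK⟩ := exists_sobolevENorm_two_dilation_le hs φ
  obtain ⟨L, hL⟩ := exists_sobolevENorm_two_dilation_le (neg_lt_neg ht) φ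
  refine ⟨(C * K * L : ℝ≥0), fun ε hε hε1 ↦ ?_⟩
  have hpow : ENNReal.ofReal (ε ^ (finrank ℝ E / 2 - s : ℝ)) *
      ENNReal.ofReal (ε ^ (finrank ℝ E / 2 - -t : ℝ)) =
        ENNReal.ofReal (ε ^ (finrank ℝ E - s + t : ℝ)) := by
    rw [← ENNReal.ofReal_mul (by positivity), ← Real.rpow_add hε]
    congr 2
    ring
  rw [← ENNReal.ofReal_le_ofReal_iff (by positivity), ofReal_norm,
    ENNReal.ofReal_mul (by positivity), ENNReal.ofReal_coe_nnreal]
  calc ‖smulLeftCLM ℂ (dilation hε.ne' φ) u (dilation hε.ne' φ)‖ₑ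
      ≤ C * sobolevENorm s 2 (dilation hε.ne' φ : 𝓢'(E, ℂ)) *
          sobolevENorm (-t) 2 (dilation hε.ne' φ : 𝓢'(E, ℂ)) :=
        hC _ _ (hasCompactSupport_dilation hε.ne' hφ)
    _ ≤ C * (K * ENNReal.ofReal (ε ^ (finrank ℝ E / 2 - s : ℝ))) *
          (L * ENNReal.ofReal (ε ^ (finrank ℝ E / 2 - -t : ℝ))) := by
        gcongr
        exacts [hK ε hε hε1, hL ε hε hε1]
    _ = (C * K * L : ℝ≥0) * ENNReal.ofReal (ε ^ (finrank ℝ E - s + t : ℝ)) := by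
        rw [← hpow]
        push_cast
        ring

end DilationEstimate

section Homogeneous

/-- Positive homogeneity of real degree `a`. The scaling relation also constrains the value at the
origin, so `‖x‖ ^ a` qualifies although it is singular there for `a < 0`. -/
def IsPosHomogeneous {E : Type*} [SMul ℝ E] (a : ℝ) (f : E → ℂ) : Prop :=
  ∀ c : ℝ, 0 < c → ∀ x, f (c • x) = (c ^ a : ℝ) * f x

theorem isPosHomogeneous_norm_rpow {E : Type*} [NormedAddCommGroup E] [NormedSpace ℝ E] (a : ℝ) :
    IsPosHomogeneous a (fun x : E ↦ ((‖x‖ ^ a : ℝ) : ℂ)) := fun c hc x ↦ by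
  dsimp only
  rw [norm_smul, Real.norm_of_nonneg hc.le, Real.mul_rpow hc.le (norm_nonneg x),
    Complex.ofReal_mul]

theorem eventually_support_comp_inv_smul_subset {E F : Type*} [NormedAddCommGroup E]
    [NormedSpace ℝ E] [Zero F] {φ : E → F} (hφ : HasCompactSupport φ) {U : Set E} (hU : U ∈ 𝓝 0) :
    ∀ᶠ ε : ℝ in 𝓝[>] 0, Function.support (fun x ↦ φ (ε⁻¹ • x)) ⊆ U := by
  have habsorbs : Absorbs ℝ U (tsupport φ) :=
    NormedSpace.isVonNBounded_of_isBounded ℝ hφ.isCompact.isBounded hU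
  have hmaps := habsorbs.eventually_nhdsNE_zero.filter_mono
    (nhdsWithin_mono 0 fun ε (hε : 0 < ε) ↦ hε.ne')
  filter_upwards [hmaps, self_mem_nhdsWithin] with ε hmaps (hε : 0 < ε) x hx
  simpa only [smul_inv_smul₀ hε.ne'] using hmaps (subset_tsupport φ hx)

variable {E : Type*} [NormedAddCommGroup E] [InnerProductSpace ℝ E] [FiniteDimensional ℝ E]
  [MeasurableSpace E] [BorelSpace E]

theorem IsPosHomogeneous.integral_dilation_sq_mul {a : ℝ} {f : E → ℂ} (hf : IsPosHomogeneous a f)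
    {ε : ℝ} (hε : 0 < ε) (φ : 𝓢(E, ℂ)) :
    ∫ x, dilation hε.ne' φ x ^ 2 * f x =
      (ε ^ (finrank ℝ E + a : ℝ) : ℝ) * ∫ x, φ x ^ 2 * f x := by
  calc ∫ x, dilation hε.ne' φ x ^ 2 * f x
      = ∫ x, (ε ^ a : ℝ) * (φ (ε⁻¹ • x) ^ 2 * f (ε⁻¹ • x)) := by
        congr 1 with x
        conv_lhs => rw [← smul_inv_smul₀ hε.ne' x, hf ε hε, smul_inv_smul₀ hε.ne']
        rw [dilation_apply]
        ring
    _ = (ε ^ a : ℝ) * (ε ^ finrank ℝ E • ∫ x, φ x ^ 2 * f x) := by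
        rw [integral_const_mul, Measure.integral_comp_inv_smul volume (fun x ↦ φ x ^ 2 * f x),
          abs_of_pos (by positivity)]
    _ = (ε ^ (finrank ℝ E + a : ℝ) : ℝ) * ∫ x, φ x ^ 2 * f x := by
        rw [Complex.real_smul, ← mul_assoc, ← Complex.ofReal_mul, Real.rpow_add hε,
          Real.rpow_natCast, mul_comm (ε ^ a)]

theorem smulLeftCLM_smulLeftCLM_regularDistribution_apply {f : E → ℂ} (hf : IsTemperedFun f)
    {g h : E → ℂ} (hg : g.HasTemperateGrowth) (hh : h.HasTemperateGrowth) (ψ : 𝓢(E, ℂ)) :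
    smulLeftCLM ℂ g (smulLeftCLM ℂ h (regularDistribution f hf)) ψ =
      ∫ x, h x * (g x * ψ x) * f x := by
  simp only [smulLeftCLM_apply_apply, regularDistribution_apply,
    SchwartzMap.smulLeftCLM_apply_apply hg, SchwartzMap.smulLeftCLM_apply_apply hh, smul_eq_mul]

theorem IsPosHomogeneous.eventually_smulLeftCLM_dilation_apply_eq {a : ℝ} {f : E → ℂ}
    (hhom : IsPosHomogeneous a f) (hf : IsTemperedFun f) {η : E → ℂ} (hη : η.HasTemperateGrowth)
    (hη1 : ∀ᶠ x in 𝓝 0, η x = 1) {φ : 𝓢(E, ℂ)} (hφ : HasCompactSupport φ) :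
    ∀ᶠ ε in 𝓝[>] 0, ∀ hε : 0 < ε,
      smulLeftCLM ℂ (dilation hε.ne' φ) (smulLeftCLM ℂ η (regularDistribution f hf))
          (dilation hε.ne' φ) =
        (ε ^ (finrank ℝ E + a : ℝ) : ℝ) * ∫ x, φ x ^ 2 * f x := by
  filter_upwards [eventually_support_comp_inv_smul_subset hφ hη1] with ε hsupport hε
  rw [smulLeftCLM_smulLeftCLM_regularDistribution_apply hf
    (dilation hε.ne' φ).hasTemperateGrowth hη, ← hhom.integral_dilation_sq_mul hε]
  congr 1 with x
  by_cases hx : dilation hε.ne' φ x = 0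
  · simp [hx]
  · rw [show η x = 1 from hsupport hx, one_mul, sq]

theorem le_of_eventually_mul_rpow_le {c K a b : ℝ} (hc : 0 < c)
    (h : ∀ᶠ ε : ℝ in 𝓝[>] 0, c * ε ^ a ≤ K * ε ^ b) : b ≤ a := by
  by_contra! hab
  have hlim : Tendsto (fun ε : ℝ ↦ K * ε ^ (b - a)) (𝓝[>] 0) (𝓝 0) := by
    have hcont : ContinuousAt (fun ε : ℝ ↦ K * ε ^ (b - a)) 0 :=
      continuousAt_const.mul (Real.continuousAt_rpow_const 0 _ (.inr (sub_pos.2 hab).le))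
    simpa only [Real.zero_rpow (sub_pos.2 hab).ne', mul_zero] using
      hcont.tendsto.mono_left nhdsWithin_le_nhds
  refine hc.not_ge (ge_of_tendsto hlim ?_)
  filter_upwards [h, self_mem_nhdsWithin] with ε hle (hε : 0 < ε)
  rw [Real.rpow_sub hε, ← mul_div_assoc, le_div_iff₀ (Real.rpow_pos_of_pos hε a)]
  exact hle

theorem IsMultiplier.sub_le_of_isPosHomogeneous [Nontrivial E] {s t a : ℝ}
    (hs : -(finrank ℝ E / 2 : ℝ) < s) (ht : t < finrank ℝ E / 2) {f : E → ℂ}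
    (hf : IsTemperedFun f) (hhom : IsPosHomogeneous a f) {η : E → ℂ} (hη : η.HasTemperateGrowth)
    (hη1 : ∀ᶠ x in 𝓝 0, η x = 1)
    (hmult : IsMultiplier s 2 t 2 (smulLeftCLM ℂ η (regularDistribution f hf)))
    {φ : 𝓢(E, ℂ)} (hφ : HasCompactSupport φ) (hφf : ∫ x, φ x ^ 2 * f x ≠ 0) :
    t - s ≤ a := by
  obtain ⟨K, hK⟩ := hmult.exists_norm_smulLeftCLM_dilation_apply_le hs ht hφ
  suffices h : (finrank ℝ E - s + t : ℝ) ≤ finrank ℝ E + a by linarith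
  refine le_of_eventually_mul_rpow_le (K := K) (norm_pos_iff.2 hφf) ?_
  filter_upwards [hhom.eventually_smulLeftCLM_dilation_apply_eq hf hη hη1 hφ,
    Ioc_mem_nhdsGT zero_lt_one] with ε hpairing ⟨hε, hε1⟩
  have hnorm := hK ε hε hε1
  rwa [hpairing hε, norm_mul, Complex.norm_real, Real.norm_of_nonneg (by positivity),
    mul_comm] at hnorm

end Homogeneous

section Power

theorem powFun_eq_norm_rpow {n : ℕ} {α : ℝ} (hα : α ≠ 0) :
    powFun n α = fun x ↦ ((‖x‖ ^ (-α) : ℝ) : ℂ) := by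
  ext x
  rw [powFun]
  split_ifs with hx
  · rw [hx, norm_zero, Real.zero_rpow (neg_ne_zero.2 hα), Complex.ofReal_zero]
  · rw [Real.rpow_neg (norm_nonneg x), one_div]

theorem exists_hasCompactSupport_integral_sq_mul_norm_rpow_ne_zero {E : Type*}
    [NormedAddCommGroup E] [InnerProductSpace ℝ E] [FiniteDimensional ℝ E] [MeasurableSpace E]
    [BorelSpace E] [Nontrivial E] {r : ℝ} (hr : -finrank ℝ E < r) :
    ∃ φ : 𝓢(E, ℂ), HasCompactSupport φ ∧ ∫ x, φ x ^ 2 * ((‖x‖ ^ r : ℝ) : ℂ) ≠ 0 := by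
  let bump : ContDiffBump (0 : E) := default
  have hc : HasCompactSupport (fun x ↦ (bump x : ℂ)) :=
    bump.hasCompactSupport.comp_left Complex.ofReal_zero
  let φ : 𝓢(E, ℂ) := hc.toSchwartzMap (Complex.ofRealCLM.contDiff.comp bump.contDiff)
  refine ⟨φ, hc, ?_⟩
  have hφ (x : E) : φ x ^ 2 * ((‖x‖ ^ r : ℝ) : ℂ) = ((bump x ^ 2 * ‖x‖ ^ r : ℝ) : ℂ) := by
    push_cast
    rfl
  have hint : Integrable (fun x : E ↦ bump x ^ 2 * ‖x‖ ^ r) := by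
    simpa only [hφ, RCLike.re_eq_complex_re, Complex.ofReal_re] using
      ((isTemperedFun_norm_rpow hr).integrable_sq_mul φ).re
  simp_rw [hφ]
  rw [integral_complex_ofReal, Complex.ofReal_ne_zero]
  refine ((integral_pos_iff_support_of_nonneg (fun x ↦ by positivity) hint).2 ?_).ne'
  have hsupport : Metric.ball (0 : E) bump.rOut \ {0} ⊆
      Function.support fun x ↦ bump x ^ 2 * ‖x‖ ^ r := by
    rintro x ⟨hx, hx0⟩
    have hbump : 0 < bump x := bump.pos_of_mem_ball hx
    exact (mul_pos (pow_pos hbump 2) (Real.rpow_pos_of_pos (norm_pos_iff.2 hx0) r)).ne'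
  refine lt_of_lt_of_le ?_ (measure_mono hsupport)
  rw [measure_sdiff_null (measure_singleton _)]
  exact Metric.measure_ball_pos _ _ bump.rOut_pos

end Power

end BesselMultiplier

end

open BesselMultiplier Topology in
theorem mainTheorem3_general {n : ℕ} {s t α : ℝ} (hs : -(n / 2 : ℝ) < s) (ht : t < n / 2)
    (hα0 : 0 < α) (hαn : α < n) {η : EuclideanSpace ℝ (Fin n) → ℂ} (hη : η.HasTemperateGrowth)
    (hη1 : ∀ᶠ x in 𝓝 0, η x = 1)
    (hmult : IsMultiplier s 2 t 2
      (smulLeftCLM ℂ η (powDistribution n α hα0 hαn))) :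
    α ≤ s - t := by
  have : NeZero n := ⟨by rintro rfl; exact (hα0.trans hαn).ne' Nat.cast_zero⟩
  obtain ⟨φ, hφ, hφα⟩ := exists_hasCompactSupport_integral_sq_mul_norm_rpow_ne_zero
    (E := EuclideanSpace ℝ (Fin n)) (r := -α) (by simpa using hαn)
  have hpow := powFun_eq_norm_rpow (n := n) hα0.ne'
  have hhom : IsPosHomogeneous (-α) (powFun n α) := hpow ▸ isPosHomogeneous_norm_rpow (-α)
  have hdegree : t - s ≤ -α :=
    hmult.sub_le_of_isPosHomogeneous (by simpa using hs) (by simpa using ht)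
      (isTemperedFun_powFun hα0 hαn) hhom hη hη1 hφ (hpow ▸ hφα)
  linarith

theorem mainTheorem3 (n : ℕ) (s t α : ℝ)
    (hs0 : 0 < s) (hsn : s < n / 2) (ht0 : 0 < t) (htn : t < n / 2) (hst : t < s)
    (η : EuclideanSpace ℝ (Fin n) → ℝ) (hη : ContDiff ℝ ∞ η) (hηc : HasCompactSupport η)
    (hη01 : ∀ x, 0 ≤ η x ∧ η x ≤ 1)
    (hη1 : ∀ x ∈ Metric.ball (0 : EuclideanSpace ℝ (Fin n)) 1, η x = 1)
    (hη2 : ∀ x ∉ Metric.ball (0 : EuclideanSpace ℝ (Fin n)) 2, η x = 0)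
    (hα0 : 0 < α) (hαn : α < n / 2)
    (hmult : BesselMultiplier.IsMultiplier s 2 t 2
      (smulLeftCLM ℂ (fun x ↦ (η x : ℂ))
        (BesselMultiplier.powDistribution n α hα0
          (hαn.trans_le (half_le_self (Nat.cast_nonneg n)))))) :
    α ≤ s - t := by
  refine mainTheorem3_general (by linarith [n.cast_nonneg (α := ℝ)]) htn hα0 _ ?_ ?_ hmult
  · exact (hηc.comp_left Complex.ofReal_zero).hasTemperateGrowth
      (Complex.ofRealCLM.contDiff.comp hη)
  · filter_upwards [Metric.ball_mem_nhds 0 one_pos] with x hx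
    rw [hη1 x hx, Complex.ofReal_one]
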